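/- Let $G$ be a finite group, let $g,r\ge 0$ be integers and let $\gamma_1,\dots,\gamma_r\in G$. Let $\Sigma'$ be a connected compact orientable surface of genus $g$ with $r$ open disks removed, whose closures are pairwise disjoint, and let $$\pi_{g,r}=\Big\langle a_1,b_1,\dots,a_g,b_g,m_1,\dots,m_r \;\Big|\; \prod_{i=1}^g a_ib_ia_i^{-1}b_i^{-1}\prod_{j=1}^r m_j=1\Big\rangle$$ be its fundamental group, in which $m_j$ is the class of the $j$-th boundary circle. Write $O(\gamma)$ for the conjugacy class of $\gamma\in G$ and $C(k)$ for the centralizer of $k\in G$, and put $$X_G(\Sigma,\gamma_1,\dots,\gamma_r)=\{\varphi\in \mathrm{Hom}(\pi_{g,r},G)\;:\;\varphi(m_j)\in O(\gamma_j)\text{ for } j=1,\dots,r\},$$ on which $G$ acts by conjugation. For a finite group $H$ let $\widehat H$ be the (finite) set of isomorphism classes of irreducible finite-dimensional complex representations of $H$. Then the number of $G$-orbits is $$|X_G(\Sigma,\gamma_1,\dots,\gamma_r)/\mathrm{Ad}\,G|=\frac{\prod_{j=1}^r|O(\gamma_j)|}{|G|^{r+1}}\sum_{k\in G}|C(k)|^{2g+r-1}\sum_{\rho\in\widehat{C(k)}}\frac{\prod_{j=1}^r\mathrm{Tr}\big(\mathrm{Ind}_{C(k)}^G(\rho)(\gamma_j)\big)}{(\dim\rho)^{2g-2+r}}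 .$$ The same formula holds when $\pi_{g,r}$ and the $m_j$ are replaced by the fundamental group $\pi_1(S,x)$ of any pointed topological space $(S,x)$ and the classes of closed curves $\ell_1,\dots,\ell_r$ based at $x$, provided that there is an isomorphism $\pi_1(S,x)\cong\pi_{g,r}$ that sends the class of $\ell_j$ to a conjugate of $m_j$ for every $j$. In particular it holds for $S=\Sigma'$ and curves $\ell_j$ freely homotopic to the boundary circles. -/

import Mathlib

/-! ### Surface groups -/

/-- Names of the generators `a_i, b_i` (`i < g`) and `m_j` (`j < r`). -/
inductive SurfaceGen (g r : ℕ) : Type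
  | a (i : Fin g)
  | b (i : Fin g)
  | m (j : Fin r)

/-- The word `∏_{i} a_i b_i a_i⁻¹ b_i⁻¹ * ∏_{j} m_j`, with the factors in increasing order. -/
def surfaceRelator (g r : ℕ) : FreeGroup (SurfaceGen g r) :=
  (List.ofFn fun i : Fin g =>
      FreeGroup.of (SurfaceGen.a i) * FreeGroup.of (SurfaceGen.b i) *
        (FreeGroup.of (SurfaceGen.a i))⁻¹ * (FreeGroup.of (SurfaceGen.b i))⁻¹).prod *
    (List.ofFn fun j : Fin r => FreeGroup.of (SurfaceGen.m j)).prod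

/-- The fundamental group of the connected compact orientable surface of genus `g` with `r`
boundary circles: generators `a_i, b_i, m_j`, one relation `∏ [a_i, b_i] ∏ m_j = 1`. -/
abbrev SurfaceGroup (g r : ℕ) : Type :=
  PresentedGroup ({surfaceRelator g r} : Set (FreeGroup (SurfaceGen g r)))

/-- The class `m_j` of the `j`-th boundary circle. -/
def boundaryClass (g r : ℕ) (j : Fin r) : SurfaceGroup g r :=
  PresentedGroup.of (SurfaceGen.m j)

/-- The class in `π₁(S, x)` of a closed curve based at `x`. -/
def loopClass {S : Type*} [TopologicalSpace S] {x : S} (p : Path x x) : FundamentalGroup S x :=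
  FundamentalGroup.fromPath (Path.Homotopic.Quotient.mk p)

/-! ### Representations with prescribed boundary holonomy -/

/-- Homomorphisms `φ : Γ → G` such that, for every `j`, the holonomy `φ (c j)` along the
boundary class `c j` belongs to the conjugacy class of `γ j`. -/
def BoundaryRep {Γ G : Type*} [Group Γ] [Group G] {r : ℕ} (c : Fin r → Γ) (γ : Fin r → G) :
    Type _ :=
  {φ : Γ →* G // ∀ j, φ (c j) ∈ conjugatesOf (γ j)}

/-- `G` acts on `BoundaryRep c γ` by conjugation: `(h • φ) t = h * φ t * h⁻¹`. -/
instance BoundaryRep.instMulAction {Γ G : Type*} [Group Γ] [Group G] {r : ℕ}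
    (c : Fin r → Γ) (γ : Fin r → G) : MulAction G (BoundaryRep c γ) where
  smul h φ := ⟨(MulAut.conj h).toMonoidHom.comp φ.1, fun j =>
    IsConj.trans (φ.2 j) (isConj_iff.2 ⟨h, by simp⟩)⟩
  one_smul φ := Subtype.ext (by ext t; exact (by simp : (1 : G) * φ.1 t * 1⁻¹ = φ.1 t))
  mul_smul h k φ := Subtype.ext (by
    ext t
    exact (by group : (h * k) * φ.1 t * (h * k)⁻¹ = h * (k * φ.1 t * k⁻¹) * h⁻¹))

/-- The number of orbits `|BoundaryRep c γ / Ad G|`. -/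
noncomputable def numBoundaryRepOrbits {Γ G : Type*} [Group Γ] [Group G] {r : ℕ}
    (c : Fin r → Γ) (γ : Fin r → G) : ℕ :=
  Nat.card (MulAction.orbitRel.Quotient G (BoundaryRep c γ))

/-! ### Irreducible complex representations -/

/-- Irreducible complex representations of `H` on the spaces `ℂⁿ`. -/
structure MatrixIrrep (H : Type*) [Group H] where
  dim : ℕ
  ρ : Representation ℂ H (Fin dim → ℂ)
  irreducible : ρ.IsIrreducible

/-- Isomorphism of representations. -/
instance MatrixIrrep.instSetoid (H : Type*) [Group H] : Setoid (MatrixIrrep H) where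
  r V W := Nonempty (V.ρ.Equiv W.ρ)
  iseqv :=
    { refl := fun V => ⟨Representation.Equiv.refl V.ρ⟩
      symm := fun ⟨e⟩ => ⟨e.symm⟩
      trans := fun ⟨e⟩ ⟨f⟩ => ⟨e.trans f⟩ }

/-- The set `Ĥ` of isomorphism classes of irreducible finite-dimensional complex
representations of `H`. -/
def IrrepClass (H : Type*) [Group H] : Type _ := Quotient (MatrixIrrep.instSetoid H)

namespace IrrepClass

/-- A representative of an isomorphism class. -/
noncomputable def rep {H : Type*} [Group H] (π : IrrepClass H) : MatrixIrrep H := Quotient.out π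

/-- `dim π`. -/
noncomputable def dim {H : Type*} [Group H] (π : IrrepClass H) : ℕ := π.rep.dim

/-- `Tr (Ind_H^G (π) (x))`. -/
noncomputable def indTrace {G : Type*} [Group G] {H : Subgroup G} (π : IrrepClass H) (x : G) : ℂ :=
  (Representation.ind H.subtype π.rep.ρ).character x

/-- A finite group has finitely many classes of irreducible representations, because their
characters are linearly independent. -/
instance instFinite (H : Type*) [Group H] [Finite H] : Finite (IrrepClass H) := by
  classical
  have := Fintype.ofFinite H
  have : Invertible (Nat.card H : ℂ) :=
    invertibleOfNonzero (Nat.cast_ne_zero.2 Nat.card_pos.ne')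
  have key : LinearIndependent ℂ (fun π : IrrepClass H => π.rep.ρ.character) := by
    rw [linearIndependent_iff']
    intro s f hf π hπ
    have h1 : ∀ σ ∈ s, f σ * ((Nat.card H : ℂ)⁻¹ *
        ∑ x : H, σ.rep.ρ.character x * π.rep.ρ.character x⁻¹) = if σ = π then f σ else 0 := by
      intro σ _
      have := σ.rep.irreducible
      have := π.rep.irreducible
      rw [Representation.char_orthonormal]
      by_cases h : σ = π
      · subst h
        rw [if_pos ⟨Representation.Equiv.refl _⟩]
        simp
      · rw [if_neg, if_neg h, mul_zero]
        rintro ⟨e⟩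
        apply h
        have h2 : (Quotient.mk _ σ.rep : IrrepClass H) = Quotient.mk _ π.rep :=
          Quotient.sound ⟨e.symm⟩
        exact (Quotient.out_eq σ).symm.trans (h2.trans (Quotient.out_eq π))
    have h3 : ∑ σ ∈ s, f σ * ((Nat.card H : ℂ)⁻¹ *
        ∑ x : H, σ.rep.ρ.character x * π.rep.ρ.character x⁻¹) = 0 := by
      have h4 : ∀ x : H, ∑ σ ∈ s, f σ * σ.rep.ρ.character x = 0 := fun x => by
        simpa using congrFun hf x
      calc _ = (Nat.card H : ℂ)⁻¹ * ∑ x : H,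
            (∑ σ ∈ s, f σ * σ.rep.ρ.character x) * π.rep.ρ.character x⁻¹ := by
            simp_rw [Finset.sum_mul, Finset.mul_sum]
            rw [Finset.sum_comm]
            exact Finset.sum_congr rfl fun x _ => Finset.sum_congr rfl fun σ _ => by ring
        _ = 0 := by simp [h4]
    rw [Finset.sum_congr rfl h1] at h3
    simpa [hπ] using h3
  exact key.finite

noncomputable instance instFintype (H : Type*) [Group H] [Finite H] : Fintype (IrrepClass H) :=
  Fintype.ofFinite _

end IrrepClass

/-- The number
`∏ⱼ |O(γⱼ)| / |G|^(r+1) * ∑_{k ∈ G} |C(k)|^(2g+r-1) *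
  ∑_{π ∈ Ĉ(k)} ∏ⱼ Tr (Ind_{C(k)}^G (π) (γⱼ)) / (dim π)^(2g-2+r)`. -/
noncomputable def mednykhSum {G : Type*} [Group G] [Fintype G] (g : ℕ) {r : ℕ} (γ : Fin r → G) :
    ℂ :=
  (∏ j, (Nat.card (conjugatesOf (γ j)) : ℂ)) / (Nat.card G : ℂ) ^ (r + 1) *
    ∑ k : G, (Nat.card (Subgroup.centralizer {k}) : ℂ) ^ (2 * (g : ℤ) + (r : ℤ) - 1) *
      ∑ π : IrrepClass (Subgroup.centralizer {k}),
        (∏ j, π.indTrace (γ j)) / (π.dim : ℂ) ^ (2 * (g : ℤ) - 2 + (r : ℤ))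

/-! By Burnside's lemma the number of orbits is the average over `k` of the number of
representations fixed by `k`, and these are the ones with values in `C = C(k)` (`fixedByEquiv`). It
remains to count solutions of the surface relation in `C` with boundary values in the sets `C ∩
O(γ_j)`.

This is Frobenius' count (`card_surfaceWord_eq_one`). The regular character `∑ dim π • χ_π` detects
`surfaceWord t = 1`. By Schur's lemma, in an irreducible representation of dimension `d` a sum over
all commutators is the scalar `(|C|/d)^2`, and a sum over a conjugation-invariant set is a scalar
given by its character sum. Hence the sum over all tuples factors. Finally the sum of `χ_π` over `C
∩ O(γ)` is `|C||O(γ)|/|G|` times the induced character at `γ` (`sum_character_conjugatesOf`). -/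

/-! ### Characters of finite groups -/

/-- Irreducibility is invariant under isomorphism of representations. -/
theorem Representation.Equiv.isIrreducible {k H V W : Type*} [Field k] [Group H]
    [AddCommGroup V] [Module k V] [AddCommGroup W] [Module k W]
    {ρ : Representation k H V} {σ : Representation k H W} (e : ρ.Equiv σ) [ρ.IsIrreducible] :
    σ.IsIrreducible := by
  have hcomm : ∀ (h : H) (v : V), e.toLinearEquiv (ρ h v) = σ h (e.toLinearEquiv v) :=
    fun h v => e.toIntertwiningMap.isIntertwining _ _ h v
  have hmem : ∀ (p : Subrepresentation σ) (v : V),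
      (e.toLinearEquiv v ∈ p.toSubmodule) = (v ∈ p.toSubmodule.comap e.toLinearEquiv.toLinearMap) :=
    fun _ _ => rfl
  -- Preimage under `e` is injective on subrepresentations and respects `⊥` and `⊤`, so the
  -- dichotomy for `ρ` passes to `σ`.
  let pull : Subrepresentation σ → Subrepresentation ρ := fun p =>
    ⟨p.toSubmodule.comap e.toLinearEquiv.toLinearMap, fun h v hv => by
      rw [← hmem, hcomm]
      exact p.apply_mem_toSubmodule h hv⟩
  have hinj : Function.Injective pull := fun p q hpq => by
    apply Subrepresentation.toSubmodule_injective
    exact Submodule.comap_injective_of_surjective e.toLinearEquiv.surjective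
      (congrArg Subrepresentation.toSubmodule hpq)
  have htop : pull ⊤ = ⊤ := rfl
  have hbot : pull ⊥ = ⊥ := Subrepresentation.toSubmodule_injective
    (LinearMap.ker_eq_bot.2 e.toLinearEquiv.injective)
  have hne : (⊥ : Subrepresentation σ) ≠ ⊤ := fun h => by
    have := congrArg pull h
    rw [htop, hbot] at this
    exact bot_ne_top this
  have : Nontrivial (Subrepresentation σ) := ⟨⟨_, _, hne⟩⟩
  refine ⟨fun p => ?_⟩
  rcases eq_bot_or_eq_top (pull p) with h | h
  · exact Or.inl (hinj (h.trans hbot.symm))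
  · exact Or.inr (hinj (h.trans htop.symm))

/-- The character of a representation is the sum of the characters of two complementary
subrepresentations. -/
theorem Subrepresentation.character_add_of_isCompl {k H V : Type*} [Field k] [Group H]
    [AddCommGroup V] [Module k V] [FiniteDimensional k V] {ρ : Representation k H V}
    {p q : Subrepresentation ρ} (hpq : IsCompl p q) :
    ρ.character = p.toRepresentation.character + q.toRepresentation.character := by
  have hc : IsCompl p.toSubmodule q.toSubmodule := by
    refine ⟨disjoint_iff.2 ?_, codisjoint_iff.2 ?_⟩
    · rw [← Subrepresentation.toSubmodule_inf, disjoint_iff.1 hpq.1]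
      rfl
    · rw [← Subrepresentation.toSubmodule_sup, codisjoint_iff.1 hpq.2]
      rfl
  funext h
  change LinearMap.trace k V (ρ h) = LinearMap.trace k _ (p.toRepresentation h) +
    LinearMap.trace k _ (q.toRepresentation h)
  -- Under `p × q ≃ V` the action becomes block diagonal.
  rw [← LinearMap.trace_prodMap', ← LinearMap.trace_conj' _
    (Submodule.prodEquivOfIsCompl _ _ hc)]
  congr 1
  apply LinearMap.ext fun v => ?_
  obtain ⟨⟨x, y⟩, rfl⟩ := (Submodule.prodEquivOfIsCompl _ _ hc).surjective v
  rw [LinearEquiv.conj_apply_apply, LinearEquiv.symm_apply_apply]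
  simp only [Submodule.coe_prodEquivOfIsCompl', LinearMap.prodMap_apply, map_add]
  rfl

namespace IrrepClass

variable {H : Type*} [Group H]

instance isIrreducible_rep (π : IrrepClass H) : π.rep.ρ.IsIrreducible := π.rep.irreducible

/-- Every irreducible complex representation has the character of one of the classes. -/
theorem exists_character_eq {V : Type*} [AddCommGroup V] [Module ℂ V] [FiniteDimensional ℂ V]
    (ρ : Representation ℂ H V) [ρ.IsIrreducible] :
    ∃ π : IrrepClass H, π.rep.ρ.character = ρ.character := by
  let e : V ≃ₗ[ℂ] (Fin (Module.finrank ℂ V) → ℂ) := (Module.finBasis ℂ V).equivFun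
  let σ : Representation ℂ H (Fin (Module.finrank ℂ V) → ℂ) :=
    { toFun := fun h => e.conj (ρ h)
      map_one' := by rw [map_one]; exact e.conj_id
      map_mul' := fun x y => by rw [map_mul]; exact e.conj_comp _ _ }
  have f : ρ.Equiv σ := Representation.Equiv.mk e fun h => by
    ext v : 1
    simp [σ, LinearEquiv.conj_apply]
  let W : MatrixIrrep H := ⟨_, σ, f.isIrreducible⟩
  refine ⟨Quotient.mk _ W, ?_⟩
  -- The chosen representative of the class of `W` is only isomorphic to `W`, which suffices for
  -- characters.
  obtain ⟨e'⟩ : Nonempty ((Quotient.out (Quotient.mk _ W : IrrepClass H)).ρ.Equiv W.ρ) :=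
    Quotient.exact (Quotient.out_eq (Quotient.mk _ W : IrrepClass H))
  exact (Representation.char_iso e').trans (Representation.char_iso f).symm

/-- The irreducible characters span all characters. -/
theorem character_mem_span [Finite H] {V : Type*} [AddCommGroup V] [Module ℂ V]
    [FiniteDimensional ℂ V] (ρ : Representation ℂ H V) :
    ρ.character ∈ Submodule.span ℂ (Set.range fun π : IrrepClass H => π.rep.ρ.character) := by
  induction hn : Module.finrank ℂ V using Nat.strong_induction_on generalizing V with
  | _ n ih =>
    subst hn
    by_cases hirr : ρ.IsIrreducible
    · obtain ⟨π, hπ⟩ := exists_character_eq ρ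
      exact Submodule.subset_span ⟨π, hπ⟩
    rcases subsingleton_or_nontrivial V with hV | hV
    · have : ρ.character = 0 := by
        funext h
        have h0 : ρ h = 0 := LinearMap.ext fun v => Subsingleton.elim _ _
        change LinearMap.trace ℂ V (ρ h) = 0
        rw [h0, map_zero]
      rw [this]
      exact Submodule.zero_mem _
    · have hne : (⊥ : Subrepresentation ρ) ≠ ⊤ := fun h =>
        bot_ne_top (α := Submodule ℂ V) (congrArg Subrepresentation.toSubmodule h)
      have : Nontrivial (Subrepresentation ρ) := ⟨⟨_, _, hne⟩⟩
      obtain ⟨p, hp⟩ : ∃ p : Subrepresentation ρ, ¬ (p = ⊥ ∨ p = ⊤) := by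
        by_contra! h
        exact hirr ⟨h⟩
      push Not at hp
      have hlt : ∀ s : Subrepresentation ρ, s ≠ ⊤ →
          Module.finrank ℂ s.toSubmodule < Module.finrank ℂ V := fun s hs =>
        Submodule.finrank_lt (lt_top_iff_ne_top.2 fun h =>
          hs (Subrepresentation.toSubmodule_injective h)).ne
      -- Maschke's theorem needs `|H|` invertible; it supplies the complement `q`.
      have : NeZero (Nat.card H : ℂ) := ⟨Nat.cast_ne_zero.2 Nat.card_pos.ne'⟩
      obtain ⟨q, hpq⟩ := exists_isCompl p
      have hq : q ≠ ⊤ := fun h => hp.1 (by simpa [h] using hpq.inf_eq_bot)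
      rw [Subrepresentation.character_add_of_isCompl hpq]
      exact Submodule.add_mem _ (ih _ (hlt p hp.2) p.toRepresentation rfl)
        (ih _ (hlt q hq) q.toRepresentation rfl)

/-- First orthogonality relation. -/
theorem sum_character_mul_character_inv [Fintype H] (σ π : IrrepClass H) [Decidable (σ = π)] :
    ∑ x : H, σ.rep.ρ.character x * π.rep.ρ.character x⁻¹ =
      if σ = π then (Nat.card H : ℂ) else 0 := by
  have hH : (Nat.card H : ℂ) ≠ 0 := Nat.cast_ne_zero.2 Nat.card_pos.ne'
  have : Invertible (Nat.card H : ℂ) := invertibleOfNonzero hH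
  have key := Representation.char_orthonormal σ.rep.ρ π.rep.ρ
  by_cases h : σ = π
  · subst h
    rw [if_pos ⟨Representation.Equiv.refl _⟩] at key
    rw [if_pos rfl]
    field_simp at key
    exact key
  · rw [if_neg, mul_eq_zero_iff_left (inv_ne_zero hH)] at key
    · rw [key, if_neg h]
    · rintro ⟨e⟩
      apply h
      have h2 : (Quotient.mk _ σ.rep : IrrepClass H) = Quotient.mk _ π.rep :=
        Quotient.sound ⟨e.symm⟩
      exact (Quotient.out_eq σ).symm.trans (h2.trans (Quotient.out_eq π))

theorem dim_ne_zero (π : IrrepClass H) : (π.dim : ℂ) ≠ 0 := by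
  intro h
  have h0 : π.rep.dim = 0 := Nat.cast_eq_zero.1 h
  have : IsEmpty (Fin π.rep.dim) := by rw [h0]; infer_instance
  exact bot_ne_top (α := Subrepresentation π.rep.ρ)
    (Subrepresentation.toSubmodule_injective (Subsingleton.elim _ _))

theorem finrank_rep (π : IrrepClass H) : Module.finrank ℂ (Fin π.rep.dim → ℂ) = π.dim := by
  simp [dim]

theorem character_one (π : IrrepClass H) : π.rep.ρ.character 1 = π.dim := by
  rw [Representation.char_one, finrank_rep]

end IrrepClass

/-- The trace of the endomorphism of `k[X]` given by a map `f : X → X` is the number of fixed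
points of `f`. -/
theorem MonoidAlgebra.trace_mapDomainLinearMap {k X : Type*} [Field k] [Finite X]
    (f : X → X) :
    LinearMap.trace k (MonoidAlgebra k X) (MonoidAlgebra.mapDomainLinearMap k k f) =
      (Nat.card {x // f x = x} : k) := by
  classical
  have := Fintype.ofFinite X
  let b : Module.Basis X k (MonoidAlgebra k X) := Module.Basis.ofRepr (coeffLinearEquiv k)
  rw [LinearMap.trace_eq_matrix_trace k b, Matrix.trace]
  have hb : ∀ x, b x = MonoidAlgebra.single x 1 := fun x => rfl
  have : ∀ x, (LinearMap.toMatrix b b (mapDomainLinearMap k k f)).diag x =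
      if f x = x then 1 else 0 := fun x => by
    rw [Matrix.diag_apply, LinearMap.toMatrix_apply, hb]
    change (mapDomainLinearMap k k f (MonoidAlgebra.single x 1)).coeff x = _
    simp [Finsupp.single_apply]
  rw [Finset.sum_congr rfl fun x _ => this x]
  simp [Nat.card_eq_fintype_card, Fintype.card_subtype]

namespace IrrepClass

/-- The regular character is `∑ π, dim π • χ_π`. -/
theorem sum_dim_mul_character {H : Type*} [Group H] [Finite H] (h : H) [Decidable (h = 1)] :
    ∑ π : IrrepClass H, (π.dim : ℂ) * π.rep.ρ.character h =
      if h = 1 then (Nat.card H : ℂ) else 0 := by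
  classical
  have := Fintype.ofFinite H
  have hH : (Nat.card H : ℂ) ≠ 0 := Nat.cast_ne_zero.2 Nat.card_pos.ne'
  have hreg : ∀ x : H, (Representation.leftRegular ℂ H).character x =
      if x = 1 then (Nat.card H : ℂ) else 0 := fun x => by
    have := MonoidAlgebra.trace_mapDomainLinearMap (k := ℂ) (fun y : H => x • y)
    refine this.trans ?_
    split_ifs with hx
    · subst hx
      simp
    · simp [hx]
  obtain ⟨c, hc⟩ := (Submodule.mem_span_range_iff_exists_fun ℂ).1
    (character_mem_span (Representation.leftRegular ℂ H))
  -- Pair the regular character with `χ_π`: its support is `{1}`, which gives `|H| χ_π(1)`, while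
  -- orthogonality gives `|H| c π`.
  have hcoef : ∀ π : IrrepClass H, c π = π.dim := fun π => by
    have h1 : ∑ x : H, (Representation.leftRegular ℂ H).character x * π.rep.ρ.character x⁻¹ =
        Nat.card H * π.dim := by
      simp [hreg, -Representation.char_one, character_one]
    have h2 : ∑ x : H, (Representation.leftRegular ℂ H).character x * π.rep.ρ.character x⁻¹ =
        Nat.card H * c π := by
      simp_rw [← hc, Finset.sum_apply, Finset.sum_mul, Pi.smul_apply, smul_eq_mul, mul_assoc]
      rw [Finset.sum_comm]
      simp_rw [← Finset.mul_sum, sum_character_mul_character_inv]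
      simp [mul_comm]
    exact mul_left_cancel₀ hH (h2.symm.trans h1)
  trans (Representation.leftRegular ℂ H).character h
  · rw [← hc]
    simp [hcoef]
  · rw [hreg]
    split_ifs <;> rfl

end IrrepClass

/-! ### Sums over a finite group in an irreducible representation -/

namespace Representation

variable {H V : Type*} [Group H] [AddCommGroup V] [Module ℂ V] [FiniteDimensional ℂ V]
  (ρ : Representation ℂ H V)

/-- Schur's lemma: an equivariant endomorphism of an irreducible representation is a scalar,
which its trace determines. -/
theorem IsIrreducible.eq_smul_one_of_commute [ρ.IsIrreducible] (T : Module.End ℂ V)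
    (hT : ∀ h, T * ρ h = ρ h * T) :
    T = (LinearMap.trace ℂ V T / Module.finrank ℂ V) • 1 := by
  obtain ⟨c, hc⟩ := IsIrreducible.algebraMap_intertwiningMap_bijective_of_isAlgClosed
    (ρ := ρ) |>.2 ⟨T, hT⟩
  have hTc : T = c • 1 := (congrArg IntertwiningMap.toLinearMap hc).symm
  have hd : (Module.finrank ℂ V : ℂ) ≠ 0 := by
    intro h
    have hs : Subsingleton V := Module.finrank_zero_iff.1 (Nat.cast_eq_zero.1 h)
    exact bot_ne_top (α := Subrepresentation ρ)
      (Subrepresentation.toSubmodule_injective (Subsingleton.elim _ _))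
  rw [hTc, map_smul, LinearMap.trace_one, smul_eq_mul, mul_div_cancel_right₀ _ hd]

variable [Fintype H]

/-- A class function acts on an irreducible representation by a scalar. -/
theorem IsIrreducible.sum_smul_eq_smul_one [ρ.IsIrreducible] (f : H → ℂ)
    (hf : ∀ h x, f (h * x * h⁻¹) = f x) :
    ∑ x, f x • ρ x = ((∑ x, f x * ρ.character x) / Module.finrank ℂ V) • 1 := by
  rw [IsIrreducible.eq_smul_one_of_commute ρ (∑ x, f x • ρ x)]
  · simp [character]
  · intro h
    rw [Finset.sum_mul, Finset.mul_sum]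
    -- Reindex by `ρ x * ρ h = ρ h * ρ (h⁻¹ * x * h)`.
    refine Fintype.sum_equiv (MulAut.conj h⁻¹).toEquiv _ _ fun x => ?_
    have h1 : f ((MulAut.conj h⁻¹).toEquiv x) = f x := hf h⁻¹ x
    rw [h1, smul_mul_assoc, mul_smul_comm, ← map_mul, ← map_mul]
    simp [mul_assoc]

/-- The sum of all commutators acts on an irreducible representation by a scalar. -/
theorem IsIrreducible.sum_commutator_eq_smul_one [ρ.IsIrreducible] :
    ∑ p : H × H, ρ (p.1 * p.2 * p.1⁻¹ * p.2⁻¹) =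
      ((Nat.card H : ℂ) / Module.finrank ℂ V) ^ 2 • 1 := by
  have hH : (Nat.card H : ℂ) ≠ 0 := Nat.cast_ne_zero.2 Nat.card_pos.ne'
  have h1 : ∀ b, ∑ a, ρ (a * b * a⁻¹) =
      ((Nat.card H : ℂ) * ρ.character b / Module.finrank ℂ V) • 1 := fun b => by
    rw [IsIrreducible.eq_smul_one_of_commute ρ (∑ a, ρ (a * b * a⁻¹))]
    · congr 2
      rw [map_sum]
      change ∑ a, ρ.character (a * b * a⁻¹) = _
      simp
    · intro h
      rw [Finset.sum_mul, Finset.mul_sum]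
      refine Fintype.sum_equiv (Equiv.mulLeft h⁻¹) _ _ fun x => ?_
      rw [← map_mul, ← map_mul]
      simp [mul_assoc]
  -- The trace of this scalar operator is `|H|`, by orthonormality of the character with itself.
  have h2 : ∑ b, ρ.character b⁻¹ • ρ b = ((Nat.card H : ℂ) / Module.finrank ℂ V) • 1 := by
    rw [IsIrreducible.sum_smul_eq_smul_one]
    · have : Invertible (Nat.card H : ℂ) := invertibleOfNonzero hH
      have key := char_orthonormal ρ ρ
      rw [if_pos ⟨Equiv.refl ρ⟩] at key
      have : ∑ x, ρ.character x⁻¹ * ρ.character x = Nat.card H := by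
        simp_rw [mul_comm (ρ.character _⁻¹)]
        field_simp at key
        exact key
      rw [this]
    · intro h x
      rw [← char_conj ρ x⁻¹ h]
      simp [mul_assoc]
  calc ∑ p : H × H, ρ (p.1 * p.2 * p.1⁻¹ * p.2⁻¹)
      = ∑ b, (∑ a, ρ (a * b * a⁻¹)) * ρ b⁻¹ := by
        rw [Fintype.sum_prod_type_right]
        simp [Finset.sum_mul]
    _ = ((Nat.card H : ℂ) / Module.finrank ℂ V) • ∑ b, ρ.character b • ρ b⁻¹ := by
        rw [Finset.smul_sum]
        refine Finset.sum_congr rfl fun b _ => ?_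
        rw [h1, smul_mul_assoc, one_mul, smul_smul]
        congr 1
        ring
    _ = _ := by
        rw [← Fintype.sum_equiv (Equiv.inv H) (fun b => ρ.character b⁻¹ • ρ b) _
          (fun b => by simp), h2, smul_smul, sq]

end Representation

/-- Distributivity for ordered products: the sum over all tuples of the products of the
entries is the product of the sums. -/
theorem Fintype.sum_prod_ofFn {A X : Type*} [Semiring A] [Fintype X] {n : ℕ}
    (F : Fin n → X → A) :
    ∑ x : Fin n → X, (List.ofFn fun i => F i (x i)).prod =
      (List.ofFn fun i => ∑ y, F i y).prod := by
  induction n with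
  | zero => simp
  | succ n ih =>
    rw [← (Fin.consEquiv fun _ => X).sum_comp, Fintype.sum_prod_type]
    simp [Fin.consEquiv, List.ofFn_succ, ← Finset.mul_sum, ih, Finset.sum_mul]

theorem List.prod_ofFn_smul {R A : Type*} [CommSemiring R] [Semiring A] [Algebra R A] {n : ℕ}
    (c : Fin n → R) (a : Fin n → A) :
    (List.ofFn fun i => c i • a i).prod = (∏ i, c i) • (List.ofFn a).prod := by
  induction n with
  | zero => simp
  | succ n ih => simp [List.ofFn_succ, ih, Fin.prod_univ_succ, smul_smul, mul_comm]

/-! ### Counting solutions of the surface relation -/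

/-- The value of the surface relator at a tuple of elements. -/
def surfaceWord {H : Type*} [Group H] {g r : ℕ} (t : (Fin g → H × H) × (Fin r → H)) : H :=
  (List.ofFn fun i => (t.1 i).1 * (t.1 i).2 * (t.1 i).1⁻¹ * (t.1 i).2⁻¹).prod *
    (List.ofFn t.2).prod

namespace IrrepClass

variable {H : Type*} [Group H] {g r : ℕ}

/-- Replacing the character by `ρ` makes the sum an ordered product of scalars: each commutator
contributes `d^(-2)`, each boundary factor `d^(-1)`, and the final trace returns one `d`. The
exponent is an integer since it is `-1` for `g = r = 0`. -/
theorem sum_prod_mul_character_surfaceWord [Fintype H] (f : Fin r → H → ℂ)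
    (hf : ∀ j h x, f j (h * x * h⁻¹) = f j x) (π : IrrepClass H) :
    ∑ t : (Fin g → H × H) × (Fin r → H), (∏ j, f j (t.2 j)) * π.rep.ρ.character (surfaceWord t) =
      (Nat.card H : ℂ) ^ (2 * g) * (∏ j, ∑ x, f j x * π.rep.ρ.character x) /
        (π.dim : ℂ) ^ (2 * (g : ℤ) - 1 + (r : ℤ)) := by
  set ρ := π.rep.ρ with hρ
  have hd := π.dim_ne_zero
  have key : ∑ t : (Fin g → H × H) × (Fin r → H), (∏ j, f j (t.2 j)) • ρ (surfaceWord t) =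
      (((Nat.card H : ℂ) / π.dim) ^ (2 * g) *
        ∏ j, ((∑ x, f j x * ρ.character x) / π.dim)) • 1 := by
    calc _ = (∑ a : Fin g → H × H, (List.ofFn fun i =>
            ρ ((a i).1 * (a i).2 * (a i).1⁻¹ * (a i).2⁻¹)).prod) *
          ∑ c : Fin r → H, (List.ofFn fun j => f j (c j) • ρ (c j)).prod := by
          rw [Fintype.sum_prod_type, Finset.sum_mul]
          refine Finset.sum_congr rfl fun a _ => ?_
          rw [Finset.mul_sum]
          refine Finset.sum_congr rfl fun c _ => ?_
          rw [List.prod_ofFn_smul, mul_smul_comm, surfaceWord, map_mul, map_list_prod,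
            map_list_prod, List.map_ofFn, List.map_ofFn]
          rfl
      _ = (List.ofFn fun _ : Fin g => ((Nat.card H : ℂ) / π.dim) ^ 2 •
            (1 : Module.End ℂ (Fin π.rep.dim → ℂ))).prod *
          (List.ofFn fun j => ((∑ x, f j x * ρ.character x) / π.dim) •
            (1 : Module.End ℂ (Fin π.rep.dim → ℂ))).prod := by
          rw [Fintype.sum_prod_ofFn (fun _ (p : H × H) => ρ (p.1 * p.2 * p.1⁻¹ * p.2⁻¹)),
            Fintype.sum_prod_ofFn (fun j x => f j x • ρ x)]
          simp_rw [hρ, Representation.IsIrreducible.sum_commutator_eq_smul_one,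
            Representation.IsIrreducible.sum_smul_eq_smul_one _ _ (hf _), finrank_rep]
      _ = _ := by
          rw [List.prod_ofFn_smul, List.prod_ofFn_smul]
          simp only [List.ofFn_const, List.prod_replicate, one_pow, Finset.prod_const,
            Finset.card_univ, Fintype.card_fin, smul_mul_smul_comm, mul_one, pow_mul]
  have := congrArg (LinearMap.trace ℂ _) key
  simp only [map_sum, map_smul, smul_eq_mul, LinearMap.trace_one, finrank_rep] at this
  refine this.trans ?_
  rw [Finset.prod_div_distrib, Finset.prod_const, Finset.card_univ, Fintype.card_fin,
    zpow_add₀ hd, zpow_sub₀ hd, zpow_one, zpow_natCast, div_pow,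
    show (2 * (g : ℤ)) = ((2 * g : ℕ) : ℤ) by push_cast; ring, zpow_natCast]
  field_simp

/-- Frobenius' formula for the number of solutions of the surface relation with boundary values
in prescribed sets that are invariant under conjugation. -/
theorem card_surfaceWord_eq_one [Finite H] (s : Fin r → Set H)
    (hs : ∀ j h x, h * x * h⁻¹ ∈ s j ↔ x ∈ s j) :
    (Nat.card {t : (Fin g → H × H) × (Fin r → H) // surfaceWord t = 1 ∧ ∀ j, t.2 j ∈ s j} : ℂ) =
      (Nat.card H : ℂ) ^ (2 * (g : ℤ) - 1) * ∑ π : IrrepClass H,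
        (∏ j, ∑ᶠ x ∈ s j, π.rep.ρ.character x) / (π.dim : ℂ) ^ (2 * (g : ℤ) - 2 + (r : ℤ)) := by
  classical
  have := Fintype.ofFinite H
  have hH : (Nat.card H : ℂ) ≠ 0 := Nat.cast_ne_zero.2 Nat.card_pos.ne'
  let f : Fin r → H → ℂ := fun j x => if x ∈ s j then 1 else 0
  have hf : ∀ j h x, f j (h * x * h⁻¹) = f j x := fun j h x => by simp [f, hs]
  have hfS : ∀ (π : IrrepClass H) j, ∑ x, f j x * π.rep.ρ.character x =
      ∑ᶠ x ∈ s j, π.rep.ρ.character x := fun π j => by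
    rw [finsum_mem_eq_finite_toFinset_sum _ (Set.toFinite _)]
    simp only [f, ite_mul, one_mul, zero_mul, ← Finset.sum_filter]
    congr 1
    ext x
    simp
  have hcount : (Nat.card H : ℂ) * Nat.card {t : (Fin g → H × H) × (Fin r → H) //
      surfaceWord t = 1 ∧ ∀ j, t.2 j ∈ s j} =
      ∑ t : (Fin g → H × H) × (Fin r → H), (∏ j, f j (t.2 j)) *
        ∑ π : IrrepClass H, (π.dim : ℂ) * π.rep.ρ.character (surfaceWord t) := by
    simp_rw [sum_dim_mul_character]
    rw [Nat.card_eq_fintype_card (α := Subtype _), Fintype.card_subtype, Finset.card_filter,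
      Nat.cast_sum, Finset.mul_sum]
    refine Finset.sum_congr rfl fun t _ => ?_
    simp only [f, Finset.prod_ite_zero, Finset.prod_const_one]
    by_cases h1 : surfaceWord t = 1 <;> by_cases h2 : ∀ j, t.2 j ∈ s j <;> simp [h1, h2]
  have hmain : (Nat.card H : ℂ) * Nat.card {t : (Fin g → H × H) × (Fin r → H) //
      surfaceWord t = 1 ∧ ∀ j, t.2 j ∈ s j} = (Nat.card H : ℂ) ^ (2 * g) *
      ∑ π : IrrepClass H, (∏ j, ∑ᶠ x ∈ s j, π.rep.ρ.character x) /
        (π.dim : ℂ) ^ (2 * (g : ℤ) - 2 + (r : ℤ)) := by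
    rw [hcount]
    simp_rw [Finset.mul_sum]
    rw [Finset.sum_comm]
    refine Finset.sum_congr rfl fun π _ => ?_
    simp_rw [mul_left_comm _ (π.dim : ℂ)]
    rw [← Finset.mul_sum, sum_prod_mul_character_surfaceWord f hf]
    simp_rw [hfS]
    have hd := π.dim_ne_zero
    -- The weight `dim π` in the regular character cancels one power of the dimension.
    rw [show 2 * (g : ℤ) - 1 + r = (2 * (g : ℤ) - 2 + r) + 1 by ring, zpow_add_one₀ hd]
    field_simp
  rw [zpow_sub₀ hH, zpow_one, show (2 * (g : ℤ)) = ((2 * g : ℕ) : ℤ) by push_cast; ring,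
    zpow_natCast, div_mul_eq_mul_div, eq_div_iff hH, mul_comm, hmain]
  push_cast
  rfl

end IrrepClass

/-! ### Characters of induced representations -/

namespace Representation

open scoped MonoidAlgebra

variable {k H G V : Type*} [Field k] [Group H] [Group G] [AddCommGroup V] [Module k V]
  [FiniteDimensional k V]

/-- The character of an induced representation. -/
theorem card_mul_character_ind [Fintype H] [Finite G] (φ : H →* G)
    (ρ : Representation k H V) (x : G) :
    (Nat.card H : k) * (ind φ ρ).character x =
      ∑ h, (Nat.card {y : G // φ h * y * x⁻¹ = y} : k) * ρ.character h := by
  let τ : Representation k H (TensorProduct k k[G] V) := tprod ((leftRegular k G).comp φ) ρ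
  let L : TensorProduct k k[G] V →ₗ[k] TensorProduct k k[G] V :=
    (MonoidAlgebra.mapDomainLinearMap k k fun y => y * x⁻¹).rTensor V
  let N : TensorProduct k k[G] V →ₗ[k] TensorProduct k k[G] V := ∑ h, τ h
  -- The induced space is the coinvariants of `τ`. The norm `N` descends to it, and following `s` by
  -- the projection is multiplication by `|H|`. Cyclicity of the trace then moves the computation to
  -- `k[G] ⊗ V`, with no division by `|H|`.
  let s : IndV φ ρ →ₗ[k] TensorProduct k k[G] V := Coinvariants.lift τ N fun h => by
    simp only [N]
    refine (Finset.sum_mul Finset.univ (fun y => τ y) (τ h)).trans ?_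
    exact Fintype.sum_equiv (Equiv.mulRight h) _ _ fun y => (map_mul τ y h).symm
  have hs : s ∘ₗ Coinvariants.mk τ = N := Coinvariants.lift_comp_mk _ _ _
  have hsec : Coinvariants.mk τ ∘ₗ s = (Nat.card H : k) • LinearMap.id := by
    apply Coinvariants.hom_ext
    rw [LinearMap.comp_assoc, hs]
    refine LinearMap.ext fun v => ?_
    simp only [N, LinearMap.comp_apply, LinearMap.sum_apply, map_sum, Coinvariants.mk_self_apply]
    simp only [Finset.sum_const, Finset.card_univ, LinearMap.smul_apply, LinearMap.id_apply,
      Nat.cast_smul_eq_nsmul, Nat.card_eq_fintype_card]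
    rfl
  have hfin : FiniteDimensional k (IndV φ ρ) :=
    Module.Finite.of_surjective (Coinvariants.mk τ) (Coinvariants.mk_surjective τ)
  have hind : ind φ ρ x ∘ₗ Coinvariants.mk τ = Coinvariants.mk τ ∘ₗ L := rfl
  calc (Nat.card H : k) * (ind φ ρ).character x
      = LinearMap.trace k _ (ind φ ρ x ∘ₗ (Coinvariants.mk τ ∘ₗ s)) := by
        rw [hsec, LinearMap.comp_smul, map_smul, LinearMap.comp_id]
        rfl
    _ = LinearMap.trace k _ (Coinvariants.mk τ ∘ₗ (L ∘ₗ s)) := by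
        rw [← LinearMap.comp_assoc, hind, LinearMap.comp_assoc]
    _ = LinearMap.trace k _ (L ∘ₗ N) := by
        rw [LinearMap.trace_comp_comm', LinearMap.comp_assoc, hs]
    _ = ∑ h, LinearMap.trace k _ (L ∘ₗ τ h) := by
        rw [← map_sum]
        exact congrArg _ (Finset.mul_sum Finset.univ (fun h => τ h) L)
    _ = _ := by
        refine Finset.sum_congr rfl fun h _ => ?_
        have : L ∘ₗ τ h = TensorProduct.map
            (MonoidAlgebra.mapDomainLinearMap k k fun y => φ h * y * x⁻¹) (ρ h) := by
          apply TensorProduct.ext'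
          intro a v
          change (MonoidAlgebra.mapDomainLinearMap k k fun y => y * x⁻¹)
            (leftRegular k G (φ h) a) ⊗ₜ[k] ρ h v = _
          rw [TensorProduct.map_tmul]
          congr 1
          induction a using MonoidAlgebra.induction_linear with
          | zero => simp
          | add f g hf hg => simp only [map_add, hf, hg]
          | single y c => simp
        rw [this, LinearMap.trace_tensorProduct', MonoidAlgebra.trace_mapDomainLinearMap]
        rfl

end Representation

/-- The number of elements conjugating `x` to a given conjugate of `x`. -/
theorem card_conj_eq_mul_card_conjugatesOf {G : Type*} [Group G] [Finite G] {x z : G}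
    (hz : z ∈ conjugatesOf x) :
    Nat.card {y : G // z * y * x⁻¹ = y} * Nat.card (conjugatesOf x) = Nat.card G := by
  have horb : conjugatesOf x = MulAction.orbit (ConjAct G) x := by
    ext w
    rw [ConjAct.mem_orbit_conjAct]
    exact isConj_comm
  obtain ⟨c, hc⟩ := isConj_iff.1 (show IsConj x z from hz)
  -- The condition says that `y` conjugates `x` to `z = c * x * c⁻¹`, so these `y` form the coset of
  -- the centralizer of `x` through `c`.
  have hstab : Nat.card {y : G // z * y * x⁻¹ = y} =
      Nat.card (MulAction.stabilizer (ConjAct G) x) := by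
    refine Nat.card_congr (Equiv.subtypeEquiv
      ((Equiv.mulLeft c⁻¹).trans ConjAct.toConjAct.toEquiv) fun y => ?_)
    rw [MulAction.mem_stabilizer_iff, ConjAct.smul_def]
    subst hc
    simp only [Equiv.trans_apply, Equiv.coe_mulLeft, MulEquiv.toEquiv_eq_coe, EquivLike.coe_coe,
      ConjAct.ofConjAct_toConjAct]
    constructor
    · intro h
      have h' : c * x * c⁻¹ * y = y * x := by rw [← mul_inv_eq_iff_eq_mul]; exact h
      calc c⁻¹ * y * x * (c⁻¹ * y)⁻¹ = c⁻¹ * (y * x) * y⁻¹ * c := by group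
        _ = x := by rw [← h']; group
    · intro h
      have h' : c⁻¹ * y * x = x * (c⁻¹ * y) := by rw [← mul_inv_eq_iff_eq_mul]; exact h
      calc c * x * c⁻¹ * y * x⁻¹ = c * (x * (c⁻¹ * y)) * x⁻¹ := by group
        _ = y := by rw [← h']; group
  rw [hstab, horb, mul_comm, ← Nat.card_prod, Nat.card_congr
    (MulAction.orbitProdStabilizerEquivGroup (ConjAct G) x)]
  rfl

/-- The sum of a character of a subgroup over the elements that are conjugate to `x` in the
whole group, as a value of the induced character. -/
theorem IrrepClass.sum_character_conjugatesOf {G : Type*} [Group G] [Finite G] {H : Subgroup G}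
    (π : IrrepClass H) (x : G) :
    ∑ᶠ h ∈ {h : H | (h : G) ∈ conjugatesOf x}, π.rep.ρ.character h =
      (Nat.card H : ℂ) * (Nat.card (conjugatesOf x) / Nat.card G) * π.indTrace x := by
  classical
  have := Fintype.ofFinite H
  have hG : (Nat.card G : ℂ) ≠ 0 := Nat.cast_ne_zero.2 Nat.card_pos.ne'
  have key := Representation.card_mul_character_ind H.subtype π.rep.ρ x
  rw [finsum_mem_eq_finite_toFinset_sum _ (Set.toFinite _), indTrace, mul_right_comm, key,
    Finset.sum_mul]
  -- An `h` not conjugate to `x` has no fixed points `y`; any other `h` has `|G|/|O(x)|` of them.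
  refine Finset.sum_subset_zero_on_sdiff (Finset.subset_univ _) (fun h hh => ?_) fun h hh => ?_
  · have : IsEmpty {y : G // H.subtype h * y * x⁻¹ = y} := ⟨fun ⟨y, hy⟩ => by
      simp only [Finset.mem_sdiff, Finset.mem_univ, Set.Finite.mem_toFinset, Set.mem_ofPred_eq,
        true_and] at hh
      refine hh (isConj_iff.2 ⟨y, ?_⟩ : IsConj x (h : G))
      have h' : (h : G) * y = y * x := by rw [← mul_inv_eq_iff_eq_mul]; exact hy
      rw [← h', mul_inv_cancel_right]⟩
    rw [Nat.card_of_isEmpty, Nat.cast_zero, zero_mul, zero_mul]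
  · have := card_conj_eq_mul_card_conjugatesOf (x := x) (z := h) (by simpa using hh)
    rw [Subgroup.coe_subtype, mul_div_assoc', mul_right_comm, ← Nat.cast_mul, this,
      mul_comm, mul_div_assoc, div_self hG, mul_one]

/-! ### Homomorphisms from surface groups -/

theorem lift_surfaceRelator {H : Type*} [Group H] {g r : ℕ} (f : SurfaceGen g r → H) :
    FreeGroup.lift f (surfaceRelator g r) =
      surfaceWord (fun i => (f (.a i), f (.b i)), fun j => f (.m j)) := by
  simp only [surfaceRelator, surfaceWord, map_mul, map_list_prod, List.map_ofFn]
  congr 2 <;> congr 1 <;> funext i <;> simp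

/-- A homomorphism from a surface group is a solution of the surface relation. -/
def surfaceGroupHomEquiv (H : Type*) [Group H] (g r : ℕ) :
    (SurfaceGroup g r →* H) ≃ {t : (Fin g → H × H) × (Fin r → H) // surfaceWord t = 1} where
  toFun φ := ⟨(fun i => (φ (.of (.a i)), φ (.of (.b i))), fun j => φ (.of (.m j))), by
    rw [← lift_surfaceRelator fun x => φ (.of x)]
    have : FreeGroup.lift (fun x => φ (.of x)) = φ.comp (PresentedGroup.mk _) := by
      ext x
      simp [PresentedGroup.of]
    rw [this, MonoidHom.comp_apply, PresentedGroup.one_of_mem (Set.mem_singleton _), map_one]⟩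
  invFun t := PresentedGroup.toGroup
    (f := fun | .a i => (t.1.1 i).1 | .b i => (t.1.1 i).2 | .m j => t.1.2 j) (by
      rintro _ rfl
      rw [lift_surfaceRelator]
      exact t.2)
  left_inv φ := by
    refine PresentedGroup.ext fun x => ?_
    rw [PresentedGroup.toGroup.of]
    cases x <;> rfl
  right_inv t := by
    apply Subtype.ext
    simp only [PresentedGroup.toGroup.of]

/-! ### Fixed points of conjugation and the orbit count -/

namespace BoundaryRep

variable {G : Type*} [Group G]

instance [Finite G] (g r : ℕ) (γ : Fin r → G) : Finite (BoundaryRep (boundaryClass g r) γ) :=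
  Finite.of_injective (fun φ => surfaceGroupHomEquiv G g r φ.1)
    ((surfaceGroupHomEquiv G g r).injective.comp Subtype.val_injective)

/-- The representations fixed by `k` are those with values in the centralizer of `k`. -/
def fixedByEquiv {Γ : Type*} [Group Γ] {r : ℕ} (c : Fin r → Γ) (γ : Fin r → G) (k : G) :
    MulAction.fixedBy (BoundaryRep c γ) k ≃
      {ψ : Γ →* Subgroup.centralizer {k} // ∀ j, (ψ (c j) : G) ∈ conjugatesOf (γ j)} where
  toFun φ := ⟨φ.1.1.codRestrict _ fun t => by
    have := congrArg (fun ψ : BoundaryRep c γ => ψ.1 t) φ.2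
    exact Subgroup.mem_centralizer_singleton_iff.2 (mul_inv_eq_iff_eq_mul.1 this).symm, φ.1.2⟩
  invFun ψ := ⟨⟨(Subgroup.subtype _).comp ψ.1, ψ.2⟩, Subtype.ext (MonoidHom.ext fun t =>
    mul_inv_eq_iff_eq_mul.2 (Subgroup.mem_centralizer_singleton_iff.1 (ψ.1 t).2).symm)⟩
  left_inv _ := rfl
  right_inv _ := rfl

/-- Frobenius' count applies in the centralizer: `C(k) ∩ O(γ_j)` is invariant under conjugation by
`C(k)`, though it may be several classes or empty. Each boundary circle adds a factor
`|C(k)||O(γ_j)|/|G|`. -/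
theorem card_fixedBy [Finite G] {g r : ℕ} (γ : Fin r → G) (k : G) :
    (Nat.card (MulAction.fixedBy (BoundaryRep (boundaryClass g r) γ) k) : ℂ) =
      (∏ j, (Nat.card (conjugatesOf (γ j)) : ℂ)) / (Nat.card G : ℂ) ^ r *
        ((Nat.card (Subgroup.centralizer {k}) : ℂ) ^ (2 * (g : ℤ) + (r : ℤ) - 1) *
          ∑ π : IrrepClass (Subgroup.centralizer {k}),
            (∏ j, π.indTrace (γ j)) / (π.dim : ℂ) ^ (2 * (g : ℤ) - 2 + (r : ℤ))) := by
  set C := Subgroup.centralizer {k} with hC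
  have hC0 : (Nat.card C : ℂ) ≠ 0 := Nat.cast_ne_zero.2 Nat.card_pos.ne'
  let e : MulAction.fixedBy (BoundaryRep (boundaryClass g r) γ) k ≃
      {t : (Fin g → C × C) × (Fin r → C) //
        surfaceWord t = 1 ∧ ∀ j, t.2 j ∈ {h : C | (h : G) ∈ conjugatesOf (γ j)}} :=
    (fixedByEquiv _ γ k).trans ((Equiv.subtypeEquiv (surfaceGroupHomEquiv C g r)
      fun ψ => Iff.rfl).trans (Equiv.subtypeSubtypeEquivSubtypeInter _
        (fun t => ∀ j, t.2 j ∈ {h : C | (h : G) ∈ conjugatesOf (γ j)})))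
  rw [Nat.card_congr e, IrrepClass.card_surfaceWord_eq_one]
  · simp_rw [IrrepClass.sum_character_conjugatesOf, Finset.prod_mul_distrib,
      Finset.prod_div_distrib, Finset.prod_const, Finset.card_univ, Fintype.card_fin]
    rw [show 2 * (g : ℤ) + r - 1 = (2 * g - 1) + r by ring, zpow_add₀ hC0, zpow_natCast]
    simp_rw [Finset.mul_sum]
    exact Finset.sum_congr rfl fun π _ => by ring
  · intro j h x
    have : IsConj ((h : G) * x * (h : G)⁻¹) (x : G) := (isConj_iff.2 ⟨(h : G), rfl⟩).symm
    exact ⟨fun H => IsConj.trans H this,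
      fun H => IsConj.trans H this.symm⟩

end BoundaryRep

theorem numBoundaryRepOrbits_eq_mednykhSum {G : Type*} [Group G] [Fintype G] (g r : ℕ)
    (γ : Fin r → G) : (numBoundaryRepOrbits (boundaryClass g r) γ : ℂ) = mednykhSum g γ := by
  classical
  have hG : (Nat.card G : ℂ) ≠ 0 := Nat.cast_ne_zero.2 Nat.card_pos.ne'
  have := Fintype.ofFinite (BoundaryRep (boundaryClass g r) γ)
  have := Fintype.ofFinite
    (MulAction.orbitRel.Quotient G (BoundaryRep (boundaryClass g r) γ))
  have burnside := MulAction.sum_card_fixedBy_eq_card_orbits_mul_card_group G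
    (BoundaryRep (boundaryClass g r) γ)
  simp_rw [← Nat.card_eq_fintype_card] at burnside
  have h := congrArg (Nat.cast : ℕ → ℂ) burnside
  push_cast [BoundaryRep.card_fixedBy] at h
  rw [← Finset.mul_sum] at h
  -- Of the `r + 1` powers of `|G|`, the boundary circles account for `r` and Burnside's average for
  -- one.
  rw [mednykhSum, pow_succ, ← div_div, div_mul_eq_mul_div, h]
  exact (mul_div_cancel_right₀ _ hG).symm

/-- The number of orbits depends on the boundary classes up to isomorphism and conjugation. -/
theorem numBoundaryRepOrbits_congr {Γ Γ' G : Type*} [Group Γ] [Group Γ'] [Group G] {r : ℕ}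
    {c : Fin r → Γ} {c' : Fin r → Γ'} (e : Γ ≃* Γ') (h : ∀ j, IsConj (e (c j)) (c' j))
    (γ : Fin r → G) : numBoundaryRepOrbits c γ = numBoundaryRepOrbits c' γ := by
  -- Homomorphisms send conjugate elements to conjugate elements, so the boundary conditions at `e
  -- (c j)` and at `c' j` agree.
  let E : BoundaryRep c γ ≃ BoundaryRep c' γ :=
    { toFun := fun φ => ⟨φ.1.comp e.symm.toMonoidHom, fun j => by
        have := (φ.1.comp e.symm.toMonoidHom).map_isConj (h j)
        simp only [MonoidHom.comp_apply, MulEquiv.coe_toMonoidHom, e.symm_apply_apply] at this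
        exact IsConj.trans (φ.2 j) this⟩
      invFun := fun φ => ⟨φ.1.comp e.toMonoidHom, fun j =>
        IsConj.trans (φ.2 j) (φ.1.map_isConj (h j)).symm⟩
      left_inv := fun φ => Subtype.ext (MonoidHom.ext fun t => congrArg φ.1 (e.symm_apply_apply t))
      right_inv := fun φ =>
        Subtype.ext (MonoidHom.ext fun t => congrArg φ.1 (e.apply_symm_apply t)) }
  have hE : ∀ (x : G) φ, E (x • φ) = x • E φ := fun _ _ => rfl
  refine Nat.card_congr (Quotient.congr E fun φ ψ => ?_)
  change (∃ x : G, x • ψ = φ) ↔ ∃ x : G, x • E ψ = E φ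
  simp_rw [← hE, E.apply_eq_iff_eq]

theorem mainTheorem4 {G : Type*} [Group G] [Fintype G] (g r : ℕ) (γ : Fin r → G) :
    (numBoundaryRepOrbits (boundaryClass g r) γ : ℂ) = mednykhSum g γ ∧
      ∀ (S : Type*) [TopologicalSpace S] (x : S) (l : Fin r → Path x x)
        (e : FundamentalGroup S x ≃* SurfaceGroup g r),
        (∀ j, IsConj (e (loopClass (l j))) (boundaryClass g r j)) →
        (numBoundaryRepOrbits (fun j => loopClass (l j)) γ : ℂ) = mednykhSum g γ := by
  refine ⟨numBoundaryRepOrbits_eq_mednykhSum g r γ, fun S _ x l e he => ?_⟩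
  rw [numBoundaryRepOrbits_congr e he, numBoundaryRepOrbits_eq_mednykhSum]
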